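/- Let $U$ be a universal conditional prefix machine, i.e. a partial computable function $(p,s)\mapsto U(p,s)$ from pairs of binary strings to binary strings such that for every condition $s$ the set of halting programs $\{p : U(p,s)\text{ is defined}\}$ is prefix-free, and which is additively optimal: for every partial computable $V$ with the same prefix-freeness property there is a constant $c_V$ such that $V(p,s)=t$ implies $U(q,s)=t$ for some $q$ with $|q|\le |p|+c_V$. Let $$K(t\mid s)=\min\{|p| : U(p,s)=t\},$$ and let $s^*$ be the shortest program $p$ with $U(p,\varepsilon)=s$, where $\varepsilon$ is the empty string (the lexicographically first one if there are several). Let $(x,y)$ denote the encoding of a pair of binary strings as one binary string by a fixed computable injective pairing function. Lemma (monotonicity of conditional information). There is a constant $c$, depending only on $U$ and on the pairing function, such that for all binary strings $x,y,z$ $$K(z\mid x^*)\;\ge\; K(z\mid (x,y)^*)-c .$$ -/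

import Mathlib

/-- A conditional prefix machine: a partial computable function of a program and a condition
(an auxiliary input), all of them binary strings, such that for every fixed condition no halting
program is a proper prefix of another halting program. -/
structure PrefixMachine where
  eval : List Bool → List Bool →. List Bool
  partrec : Partrec₂ eval
  prefixFree : ∀ s p q : List Bool, (eval p s).Dom → (eval q s).Dom → p <+: q → p = q

namespace PrefixMachine

/-- A prefix machine is universal (additively optimal) if it simulates every prefix machine, for
every condition, with programs that are longer by at most a constant depending only on the
simulated machine. -/
def IsUniversal (U : PrefixMachine) : Prop :=
  ∀ V : PrefixMachine, ∃ c : ℕ, ∀ s p t : List Bool, t ∈ V.eval p s →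
    ∃ q : List Bool, t ∈ U.eval q s ∧ q.length ≤ p.length + c

/-- On a universal machine every string has a program, whatever the condition. -/
theorem IsUniversal.exists_program {U : PrefixMachine} (hU : U.IsUniversal) (t s : List Bool) :
    ∃ p : List Bool, t ∈ U.eval p s := by
  let V : PrefixMachine :=
    { eval := fun p _ => ((if p = [] then some t else none : Option (List Bool)) :
        Part (List Bool))
      partrec := by
        refine Computable.ofOption ?_
        refine Primrec.to_comp ?_
        exact Primrec.ite (Primrec.eq.comp Primrec.fst (Primrec.const []))
          (Primrec.const _) (Primrec.const _)
      prefixFree := by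
        intro s p q hp hq _
        have key : ∀ r : List Bool,
            (((if r = [] then some t else none : Option (List Bool)) :
              Part (List Bool))).Dom → r = [] := by
          intro r hr
          by_contra h
          simp [h] at hr
        rw [key p hp, key q hq] }
  obtain ⟨c, hc⟩ := hU V
  obtain ⟨q, hq, -⟩ := hc s [] t (by simp [V])
  exact ⟨q, hq⟩

/-- The conditional complexity `K(t | s)`: the length of a shortest program that generates `t`
from `s`. The set of lengths is nonempty if `U` is universal. -/
noncomputable def condComplexity (U : PrefixMachine) (t s : List Bool) : ℕ :=
  sInf {n : ℕ | ∃ p : List Bool, t ∈ U.eval p s ∧ p.length = n}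

open Classical in
/-- The shortest description `s^*`: among the shortest programs that generate `s` from the empty
condition, the lexicographically first one, that is, the least program of `s` in the order by
length first and lexicographic order second. Such a program exists if `U` is universal, and the
value is `[]` if there is none. -/
noncomputable def star (U : PrefixMachine) (s : List Bool) : List Bool :=
  if h : {p : List Bool | s ∈ U.eval p []}.Nonempty then
    WellFounded.min (List.Shortlex.wf (r := fun a b : Bool => a < b) wellFounded_lt)
      {p : List Bool | s ∈ U.eval p []} h
  else []

end PrefixMachine

/-! From `(x,y)^*` one can compute `x`, but in general not `x^*`, so the lemma is not proved by
translating programs. It follows by counting lengths. Up to additive constants, symmetry of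
information gives `K(z | (x,y)^*) + K(x,y) ≤ K((x,y),z)`. Concatenating `x^*` with shortest programs
for `y` and `z` under condition `x^*` gives `K((x,y),z) ≤ K(x) + K(y | x^*) + K(z | x^*)`. Symmetry
of information again gives `K(x) + K(y | x^*) ≤ K(x,y)`, and `K(x,y)` cancels.

The weight lies in the symmetry of information, `exists_condComplexity_add_le`. It rests on the
Kraft–Chaitin theorem (`exists_complexity_le_of_requests`), which turns a computable list of
requested lengths of small total weight into a prefix machine, and on the coding theorem
(`exists_mass_le`), which bounds the total weight of all programs whose output has first component
`a` by a constant times `2 ^ (-K(a))`. Given `a^*`, both `a` and `K(a)` are known, so those weights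
can be rescaled by `2 ^ K(a)` and served as requests for the second components. -/

open scoped ENNReal

/-! ### Stagewise enumeration of partial computable functions. -/

/-- A partial computable function has a computable stage function which reveals every value at
exactly one stage. -/
theorem exists_enumeration_of_partrec {α σ : Type*} [Primcodable α] [Primcodable σ] {f : α →. σ}
    (hf : Partrec f) :
    ∃ g : α → ℕ → Option σ, Computable₂ g ∧
      (∀ a k x, g a k = some x → x ∈ f a) ∧
      (∀ a x, x ∈ f a → ∃ k, g a k = some x) ∧
      ∀ a j k, (g a j).isSome → (g a k).isSome → j = k := by
  obtain ⟨c, hc⟩ := Nat.Partrec.Code.exists_code.1 hf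
  let h : α → ℕ → Option σ := fun a k =>
    (Nat.Partrec.Code.evaln k c (Encodable.encode a)).bind Encodable.decode
  have hcomp : Computable₂ h := by
    refine Computable.option_bind ?_ (Computable.decode.comp Computable.snd).to₂
    exact Nat.Partrec.Code.primrec_evaln.to_comp.comp
      ((Computable.snd.pair (Computable.const c)).pair (Computable.encode.comp Computable.fst))
  have hmem : ∀ a x, x ∈ f a ↔ Encodable.encode x ∈ c.eval (Encodable.encode a) := by
    intro a x
    simp [hc, Part.mem_map_iff]
  have hsound : ∀ a k x, h a k = some x → x ∈ f a := by
    intro a k x hx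
    obtain ⟨y, hy, hxy⟩ := Option.bind_eq_some_iff.1 hx
    have h2 := Nat.Partrec.Code.evaln_sound hy
    rw [hc] at h2
    simp only [Encodable.encodek, Part.coe_some, Part.bind_some, Part.mem_map_iff] at h2
    obtain ⟨z, hz, rfl⟩ := h2
    rw [Encodable.encodek] at hxy
    cases hxy
    exact hz
  have hcompl : ∀ a x, x ∈ f a → ∃ k, h a k = some x := by
    intro a x hx
    obtain ⟨k, hk⟩ := Nat.Partrec.Code.evaln_complete.1 ((hmem a x).1 hx)
    exact ⟨k, by simp [h, Option.mem_def.1 hk]⟩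
  have hmono : ∀ a j k, j ≤ k → (h a j).isSome → (h a k).isSome := by
    intro a j k hjk hj
    obtain ⟨x, hx⟩ := Option.isSome_iff_exists.1 hj
    obtain ⟨y, hy, hxy⟩ := Option.bind_eq_some_iff.1 hx
    have := Nat.Partrec.Code.evaln_mono hjk hy
    simp [h, Option.mem_def.1 this, hxy]
  have h0 : ∀ a, h a 0 = none := by
    intro a
    simp [h, Nat.Partrec.Code.evaln]
  -- Stage `k + 1` reports only if stage `k` had no value yet. Stage `0` can be silenced because of
  -- `h0`.
  refine ⟨fun a k => Nat.casesOn k none fun k => Option.casesOn (h a k) (h a (k + 1)) fun _ => none,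
    ?_, ?_, ?_, ?_⟩
  · refine Computable.nat_casesOn Computable.snd (Computable.const none) ?_
    refine Computable.option_casesOn ?_ ?_ (Computable.const none).to₂
    · exact hcomp.comp (Computable.fst.comp Computable.fst) Computable.snd
    · exact hcomp.comp (Computable.fst.comp Computable.fst) (Computable.succ.comp Computable.snd)
  · rintro a (_ | k) x hx
    · cases hx
    · refine hsound a (k + 1) x ?_
      dsimp only at hx
      cases hk : h a k <;> simp_all
  · intro a x hx
    have hex : ∃ k, (h a k).isSome := by
      obtain ⟨k, hk⟩ := hcompl a x hx
      exact ⟨k, by simp [hk]⟩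
    classical
    have hspec := Nat.find_spec hex
    have hmin := fun m => Nat.find_min hex (m := m)
    generalize Nat.find hex = k at hspec hmin
    obtain ⟨y, hy⟩ := Option.isSome_iff_exists.1 hspec
    obtain rfl := Part.mem_unique hx (hsound a k y hy)
    refine ⟨k, ?_⟩
    cases k with
    | zero => simp [h0] at hy
    | succ k =>
      have := hmin k (Nat.lt_succ_self k)
      simp only [Option.not_isSome_iff_eq_none] at this
      simp [this, hy]
  · have key : ∀ a j k, j < k → ((Nat.casesOn j none fun j => Option.casesOn (h a j) (h a (j + 1))
        fun _ => none : Option σ)).isSome → ((Nat.casesOn k none fun k => Option.casesOn (h a k)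
        (h a (k + 1)) fun _ => none : Option σ)).isSome → False := by
      rintro a (_ | j) (_ | k) hjk hj hk
      · simp at hj
      · simp at hj
      · simp at hk
      · dsimp only at hj hk
        have h1 : (h a (j + 1)).isSome := by
          cases e : h a j <;> simp_all
        have h2 := hmono a (j + 1) k (by omega) h1
        obtain ⟨y, hy⟩ := Option.isSome_iff_exists.1 h2
        simp [hy] at hk
    intro a j k hj hk
    rcases lt_trichotomy j k with h | h | h
    · exact (key a j k h hj hk).elim
    · exact h
    · exact (key a k j h hk hj).elim

/-! ### Kraft–Chaitin: online allocation of dyadic intervals. -/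

namespace KraftChaitin

/-- The number with the given binary digits, most significant digit first. -/
def binaryValue (p : List Bool) : ℕ := p.foldl (fun n b => 2 * n + b.toNat) 0

theorem binaryValue_concat (p : List Bool) (b : Bool) :
    binaryValue (p ++ [b]) = 2 * binaryValue p + b.toNat := by
  simp [binaryValue]

theorem binaryValue_lt (p : List Bool) : binaryValue p < 2 ^ p.length := by
  induction p using List.reverseRecOn with
  | nil => simp [binaryValue]
  | append_singleton p b ih =>
    rw [binaryValue_concat, List.length_append, List.length_singleton, pow_succ]
    have := b.toNat_lt
    omega

theorem binaryValue_append (p r : List Bool) :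
    binaryValue (p ++ r) = binaryValue p * 2 ^ r.length + binaryValue r := by
  induction r using List.reverseRecOn with
  | nil => simp [binaryValue]
  | append_singleton r b ih =>
    rw [← List.append_assoc, binaryValue_concat, binaryValue_concat, ih, List.length_append,
      List.length_singleton, pow_succ]
    ring

theorem exists_binaryValue (l v : ℕ) (hv : v < 2 ^ l) :
    ∃ p : List Bool, p.length = l ∧ binaryValue p = v := by
  induction l generalizing v with
  | zero => exact ⟨[], rfl, by simp at hv; simp [binaryValue, hv]⟩
  | succ l ih =>
    obtain ⟨p, hp, hpv⟩ := ih (v / 2) (by rw [pow_succ] at hv; omega)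
    refine ⟨p ++ [decide (v % 2 = 1)], by simp [hp], ?_⟩
    rw [binaryValue_concat, hpv]
    by_cases h : v % 2 = 1 <;> simp [h] <;> omega

theorem computable_binaryValue : Computable binaryValue := by
  refine Primrec.to_comp ?_
  refine Primrec.list_foldl (h := fun (_ : List Bool) (x : ℕ × Bool) => 2 * x.1 + x.2.toNat)
    Primrec.id (Primrec.const 0) ?_
  refine Primrec.nat_add.comp (Primrec.nat_mul.comp (Primrec.const 2)
    (Primrec.fst.comp Primrec.snd)) ?_
  exact (Primrec.dom_finite Bool.toNat).comp (Primrec.snd.comp Primrec.snd)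

theorem primrec_pow : Primrec₂ ((· ^ ·) : ℕ → ℕ → ℕ) :=
  Primrec₂.unpaired'.1 Nat.Primrec.pow

/-- The least `v` such that `v / 2 ^ l` is at least `N / 2 ^ e`. -/
def slot (P : ℕ × ℕ) (l : ℕ) : ℕ := (P.1 * 2 ^ l + 2 ^ P.2 - 1) / 2 ^ P.2

theorem primrec_slot : Primrec₂ slot := by
  have hpow : Primrec fun x : (ℕ × ℕ) × ℕ => 2 ^ x.1.2 :=
    primrec_pow.comp (Primrec.const 2) (Primrec.snd.comp Primrec.fst)
  have hpow' : Primrec fun x : (ℕ × ℕ) × ℕ => 2 ^ x.2 :=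
    primrec_pow.comp (Primrec.const 2) Primrec.snd
  exact Primrec.nat_div.comp (Primrec.nat_sub.comp (Primrec.nat_add.comp
    (Primrec.nat_mul.comp (Primrec.fst.comp Primrec.fst) hpow') hpow) (Primrec.const 1)) hpow

/-- The dyadic rational `N / 2 ^ e`. -/
noncomputable def dyadic (P : ℕ × ℕ) : ℝ := P.1 / 2 ^ P.2

theorem dyadic_le_slot (P : ℕ × ℕ) (l : ℕ) : dyadic P ≤ dyadic (slot P l, l) := by
  have h : P.1 * 2 ^ l ≤ slot P l * 2 ^ P.2 := by
    have h1 : 0 < 2 ^ P.2 := by positivity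
    have := Nat.lt_div_mul_add (a := P.1 * 2 ^ l + 2 ^ P.2 - 1) h1
    unfold slot
    omega
  unfold dyadic
  rw [div_le_div_iff₀ (by positivity) (by positivity)]
  exact_mod_cast h

/-- Rounding up to the grid costs at most `2 ^ (-l)` and the interval itself another `2 ^ (-l)`.
This factor `2` is why requests may only weigh `1 / 2` in total. -/
theorem dyadic_slot_le (P : ℕ × ℕ) (l : ℕ) :
    dyadic (slot P l + 1, l) ≤ dyadic P + 2 * (2⁻¹ : ℝ) ^ l := by
  have h : slot P l * 2 ^ P.2 ≤ P.1 * 2 ^ l + 2 ^ P.2 := by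
    have := Nat.div_mul_le_self (P.1 * 2 ^ l + 2 ^ P.2 - 1) (2 ^ P.2)
    exact this.trans (Nat.sub_le _ _)
  have h' : (slot P l : ℝ) * 2 ^ P.2 ≤ P.1 * 2 ^ l + 2 ^ P.2 := by exact_mod_cast h
  have h1 : dyadic P + 2 * (2⁻¹ : ℝ) ^ l = (P.1 * 2 ^ l + 2 * 2 ^ P.2) / (2 ^ P.2 * 2 ^ l) := by
    unfold dyadic
    rw [inv_pow]
    field_simp
  rw [h1]
  unfold dyadic
  rw [div_le_div_iff₀ (by positivity) (by positivity)]
  push_cast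
  have h2 : (0 : ℝ) < 2 ^ l := by positivity
  nlinarith

/-- The left end of the free part of the unit interval after the first `n` requests. A request of
length `l` occupies the first free interval of length `2 ^ (-l)` whose ends are multiples of
`2 ^ (-l)`, and everything to the left of it is given up. -/
def pointer {τ : Type*} (r : ℕ → Option (ℕ × τ)) (n : ℕ) : ℕ × ℕ :=
  Nat.rec (0, 0) (fun n P => Option.casesOn (r n) P fun x => (slot P x.1 + 1, x.1)) n

section pointer

variable {τ : Type*} (r : ℕ → Option (ℕ × τ))

theorem pointer_succ_none {n : ℕ} (h : r n = none) : pointer r (n + 1) = pointer r n := by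
  simp [pointer, h]

theorem pointer_succ_some {n l : ℕ} {t : τ} (h : r n = some (l, t)) :
    pointer r (n + 1) = (slot (pointer r n) l + 1, l) := by
  simp [pointer, h]

theorem dyadic_lt_dyadic_succ (v l : ℕ) : dyadic (v, l) < dyadic (v + 1, l) := by
  unfold dyadic
  push_cast
  gcongr
  simp

theorem monotone_dyadic_pointer : Monotone fun n => dyadic (pointer r n) := by
  refine monotone_nat_of_le_succ fun n => ?_
  rcases h : r n with _ | ⟨l, t⟩
  · rw [pointer_succ_none r h]
  · rw [pointer_succ_some r h]
    exact (dyadic_le_slot _ l).trans (dyadic_lt_dyadic_succ _ _).le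

/-- The weight `2 ^ (-l)` of a request of length `l`. -/
noncomputable def weight : Option (ℕ × τ) → ℝ≥0∞
  | none => 0
  | some x => 2⁻¹ ^ x.1

theorem ofReal_dyadic_pointer_le (n : ℕ) :
    ENNReal.ofReal (dyadic (pointer r n)) ≤ ∑ i ∈ Finset.range n, 2 * weight (r i) := by
  induction n with
  | zero => simp [pointer, dyadic]
  | succ n ih =>
    rw [Finset.sum_range_succ]
    rcases h : r n with _ | ⟨l, t⟩
    · rw [pointer_succ_none r h]
      simpa [weight] using ih
    · rw [pointer_succ_some r h]
      refine (ENNReal.ofReal_le_ofReal (dyadic_slot_le _ l)).trans ?_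
      refine ENNReal.ofReal_add_le.trans (add_le_add ih ?_)
      rw [ENNReal.ofReal_mul (by norm_num), ENNReal.ofReal_pow (by norm_num),
        ENNReal.ofReal_inv_of_pos (by norm_num)]
      simp [weight]

/-- The pointer moves by at most twice the total weight, so it never passes `1`; hence the slot
number fits into `l` binary digits. -/
theorem slot_lt (hr : ∑' n, weight (r n) ≤ 2⁻¹) {n l : ℕ} {t : τ} (h : r n = some (l, t)) :
    slot (pointer r n) l < 2 ^ l := by
  have h1 : ENNReal.ofReal (dyadic (pointer r (n + 1))) ≤ 1 := by
    refine (ofReal_dyadic_pointer_le r _).trans ?_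
    rw [← Finset.mul_sum]
    refine (mul_le_mul_right ((ENNReal.sum_le_tsum _).trans hr) 2).trans ?_
    rw [ENNReal.mul_inv_cancel (by norm_num) (by norm_num)]
  rw [ENNReal.ofReal_le_one, pointer_succ_some r h, dyadic, div_le_one (by positivity)] at h1
  exact_mod_cast h1

/-- The request `n` is served by the program `p`. -/
def Serves (n : ℕ) (p : List Bool) : Prop :=
  ∃ t, r n = some (p.length, t) ∧ binaryValue p = slot (pointer r n) p.length

/-- Extending a string shrinks its dyadic interval, whereas different requests get disjoint
intervals, since the pointer passes the right end of each interval once it is assigned. -/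
theorem Serves.eq_of_prefix {n m : ℕ} {p q : List Bool} (hp : Serves r n p) (hq : Serves r m q)
    (hpq : p <+: q) : n = m := by
  obtain ⟨u, rfl⟩ := hpq
  obtain ⟨t, ht, hpv⟩ := hp
  obtain ⟨t', ht', hqv⟩ := hq
  have hp1 := dyadic_le_slot (pointer r n) p.length
  have hq1 := dyadic_le_slot (pointer r m) (p ++ u).length
  have hp2 := congrArg dyadic (pointer_succ_some r ht)
  have hq2 := congrArg dyadic (pointer_succ_some r ht')
  rw [← hpv] at hp1 hp2
  rw [← hqv] at hq1 hq2
  have hlt := dyadic_lt_dyadic_succ (binaryValue (p ++ u)) (p ++ u).length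
  have hlow : dyadic (binaryValue p, p.length) ≤ dyadic (binaryValue (p ++ u), (p ++ u).length) := by
    unfold dyadic
    rw [div_le_div_iff₀ (by positivity) (by positivity), binaryValue_append, List.length_append,
      pow_add]
    have : (0 : ℝ) ≤ binaryValue u * 2 ^ p.length := by positivity
    push_cast
    nlinarith
  have hhigh : dyadic (binaryValue (p ++ u) + 1, (p ++ u).length) ≤
      dyadic (binaryValue p + 1, p.length) := by
    unfold dyadic
    rw [div_le_div_iff₀ (by positivity) (by positivity), binaryValue_append, List.length_append,
      pow_add]
    have h1 : (binaryValue u : ℝ) + 1 ≤ 2 ^ u.length := by exact_mod_cast binaryValue_lt u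
    have h2 : (0 : ℝ) < 2 ^ p.length := by positivity
    push_cast
    nlinarith
  rcases lt_trichotomy n m with h | h | h
  · have := monotone_dyadic_pointer r (Nat.succ_le_of_lt h)
    dsimp only [Nat.succ_eq_add_one] at this
    linarith
  · exact h
  · have := monotone_dyadic_pointer r (Nat.succ_le_of_lt h)
    dsimp only [Nat.succ_eq_add_one] at this
    linarith

end pointer

theorem computable_pointer {r : List Bool → ℕ → Option (ℕ × List Bool)} (hr : Computable₂ r) :
    Computable₂ fun s n => pointer (r s) n := by
  refine Computable.nat_rec (h := fun (x : List Bool × ℕ) (y : ℕ × ℕ × ℕ) =>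
    Option.casesOn (r x.1 y.1) y.2 fun z => (slot y.2 z.1 + 1, z.1))
    Computable.snd (Computable.const (0, 0)) ?_
  refine Computable.option_casesOn (hr.comp (Computable.fst.comp Computable.fst)
    (Computable.fst.comp Computable.snd)) (Computable.snd.comp Computable.snd) ?_
  have hl : Computable fun x : ((List Bool × ℕ) × ℕ × ℕ × ℕ) × ℕ × List Bool => x.2.1 :=
    Computable.fst.comp Computable.snd
  refine Computable.pair (Computable.succ.comp (primrec_slot.to_comp.comp ?_ hl)) hl
  exact Computable.snd.comp (Computable.snd.comp Computable.fst)

/-- The output of the program `p` if it serves the request `n`. -/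
def output (r : ℕ → Option (ℕ × List Bool)) (p : List Bool) (n : ℕ) : Option (List Bool) :=
  (r n).bind fun x =>
    if (p.length, binaryValue p) = (x.1, slot (pointer r n) x.1) then some x.2 else none

theorem output_eq_some {r : ℕ → Option (ℕ × List Bool)} {p : List Bool} {n : ℕ} {t : List Bool} :
    output r p n = some t ↔
      r n = some (p.length, t) ∧ binaryValue p = slot (pointer r n) p.length := by
  unfold output
  rcases h : r n with _ | ⟨l, t'⟩
  · simp
  · simp only [Option.bind_some, Option.ite_none_right_eq_some, Prod.mk.injEq, Option.some.injEq]
    constructor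
    · rintro ⟨⟨rfl, h1⟩, rfl⟩
      exact ⟨⟨rfl, rfl⟩, h1⟩
    · rintro ⟨⟨rfl, rfl⟩, h1⟩
      exact ⟨⟨rfl, h1⟩, rfl⟩

theorem computable_output {r : List Bool → ℕ → Option (ℕ × List Bool)} (hr : Computable₂ r) :
    Computable₂ fun (x : List Bool × List Bool) n => output (r x.2) x.1 n := by
  have hs : Computable fun x : (List Bool × List Bool) × ℕ => x.1.2 :=
    Computable.snd.comp Computable.fst
  refine Computable.option_bind (hr.comp hs Computable.snd) ?_
  let A := ((List Bool × List Bool) × ℕ) × ℕ × List Bool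
  have hp : Computable fun x : A => x.1.1.1 :=
    Computable.fst.comp (Computable.fst.comp Computable.fst)
  have hl : Computable fun x : A => x.2.1 := Computable.fst.comp Computable.snd
  have hslot : Computable fun x : A => slot (pointer (r x.1.1.2) x.1.2) x.2.1 :=
    primrec_slot.to_comp.comp ((computable_pointer hr).comp (hs.comp Computable.fst)
      (Computable.snd.comp Computable.fst)) hl
  have hcond : Computable fun x : A => decide ((x.1.1.1.length, binaryValue x.1.1.1) =
      (x.2.1, slot (pointer (r x.1.1.2) x.1.2) x.2.1)) :=
    (Primrec.eq (α := ℕ × ℕ)).decide.to_comp.comp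
      ((Computable.list_length.comp hp).pair (computable_binaryValue.comp hp)) (hl.pair hslot)
  refine (Computable.cond hcond (Computable.option_some.comp (Computable.snd.comp Computable.snd))
    (Computable.const none)).of_eq fun x => ?_
  simp only [Bool.cond_decide]

/-- The machine that serves the requests `r s` under the condition `s`. -/
def machine (r : List Bool → ℕ → Option (ℕ × List Bool)) (hr : Computable₂ r) : PrefixMachine where
  eval p s := Nat.rfindOpt (output (r s) p)
  partrec := Partrec.rfindOpt (computable_output hr)
  prefixFree s p q hp hq hpq := by
    obtain ⟨n, t, hn⟩ := Nat.rfindOpt_dom.1 hp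
    obtain ⟨m, u, hm⟩ := Nat.rfindOpt_dom.1 hq
    obtain ⟨hn, hn'⟩ := output_eq_some.1 hn
    obtain ⟨hm, hm'⟩ := output_eq_some.1 hm
    -- No bound on the weights is needed here: a request whose slot overflows is simply served by no
    -- program.
    obtain rfl : n = m := Serves.eq_of_prefix (r s) ⟨t, hn, hn'⟩ ⟨u, hm, hm'⟩ hpq
    rw [hn] at hm
    simp only [Option.some.injEq, Prod.mk.injEq] at hm
    exact hpq.eq_of_length hm.1

theorem exists_mem_machine_eval {r : List Bool → ℕ → Option (ℕ × List Bool)} (hr : Computable₂ r)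
    {s : List Bool} (hs : ∑' n, weight (r s n) ≤ 2⁻¹) {n l : ℕ} {t : List Bool}
    (h : r s n = some (l, t)) :
    ∃ p : List Bool, p.length = l ∧ t ∈ (machine r hr).eval p s := by
  obtain ⟨p, rfl, hpv⟩ := exists_binaryValue l _ (slot_lt (r s) hs h)
  refine ⟨p, rfl, ?_⟩
  have hout : output (r s) p n = some t := output_eq_some.2 ⟨h, hpv⟩
  have hdom : (Nat.rfindOpt (output (r s) p)).Dom := Nat.rfindOpt_dom.2 ⟨n, t, hout⟩
  obtain ⟨m, hm⟩ := Nat.rfindOpt_spec (Part.get_mem hdom)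
  obtain ⟨h1, h2⟩ := output_eq_some.1 hm
  -- The search may stop at any request served by `p`, but there is only one.
  obtain rfl : n = m :=
    Serves.eq_of_prefix (r s) ⟨t, h, hpv⟩ ⟨_, h1, h2⟩ List.prefix_rfl
  have : t = (Nat.rfindOpt (output (r s) p)).get hdom := by
    rw [Option.mem_def, hout] at hm
    exact Option.some.inj hm
  rw [this]
  exact Part.get_mem hdom

end KraftChaitin

/-! ### Listing a family of partial values, with multiplicity. -/

theorem Computable.option_ite_eq {α β σ : Type*} [Primcodable α] [Primcodable β] [Primcodable σ]
    [DecidableEq β] {f g : α → β} {h : α → σ} (hf : Computable f) (hg : Computable g)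
    (hh : Computable h) : Computable fun a => if f a = g a then some (h a) else none :=
  (Computable.cond (Primrec.eq.decide.to_comp.comp hf hg) (Computable.option_some.comp hh)
    (Computable.const Option.none)).of_eq fun a => by simp only [Bool.cond_decide]

/-- A computably indexed family of partial values can be listed so that every value is listed once
for each of its indices. -/
theorem exists_listing_of_partrec {α ι σ : Type*} [Primcodable α] [Primcodable ι] [Primcodable σ]
    {R : α → ι →. σ} (hR : Partrec₂ R) :
    ∃ r : α → ℕ → Option σ, Computable₂ r ∧ (∀ a x, (∃ n, r a n = some x) ↔ ∃ i, x ∈ R a i) ∧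
      ∀ (a : α) (w : σ → ℝ≥0∞), ∑' n, (r a n).elim 0 w = ∑' i, ⨆ x ∈ R a i, w x := by
  obtain ⟨g, hg, hsound, hcompl, huniq⟩ := exists_enumeration_of_partrec hR
  -- Several numbers may decode to the same pair; testing `encode y = n` keeps one of them, so that
  -- no weight is counted twice.
  let r : α → ℕ → Option σ := fun a n =>
    (Encodable.decode (α := ι × ℕ) n).bind fun y =>
      if Encodable.encode y = n then g (a, y.1) y.2 else none
  have hr_encode : ∀ a (y : ι × ℕ), r a (Encodable.encode y) = g (a, y.1) y.2 := by
    intro a y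
    simp only [r, Encodable.encodek, Option.bind_some, if_true]
  have hr_range : ∀ a n x, r a n = some x → ∃ y : ι × ℕ, Encodable.encode y = n := by
    intro a n x hx
    obtain ⟨y, -, hy⟩ := Option.bind_eq_some_iff.1 hx
    refine ⟨y, ?_⟩
    by_contra h
    simp [h] at hy
  refine ⟨r, ?_, ?_, ?_⟩
  · refine Computable.option_bind (Computable.decode.comp Computable.snd) ?_
    have h1 : Computable fun x : (α × ℕ) × ι × ℕ => decide (Encodable.encode x.2 = x.1.2) :=
      (Primrec.eq (α := ℕ)).decide.to_comp.comp (Computable.encode.comp Computable.snd)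
        (Computable.snd.comp Computable.fst)
    have h2 : Computable fun x : (α × ℕ) × ι × ℕ => g (x.1.1, x.2.1) x.2.2 :=
      hg.comp ((Computable.fst.comp Computable.fst).pair (Computable.fst.comp Computable.snd))
        (Computable.snd.comp Computable.snd)
    refine (Computable.cond h1 h2 (Computable.const none)).of_eq fun a => ?_
    simp only [Bool.cond_decide]
  · intro a x
    constructor
    · rintro ⟨n, hn⟩
      obtain ⟨y, rfl⟩ := hr_range a n x hn
      rw [hr_encode] at hn
      exact ⟨y.1, hsound _ _ _ hn⟩
    · rintro ⟨i, hi⟩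
      obtain ⟨k, hk⟩ := hcompl (a, i) x hi
      exact ⟨Encodable.encode (i, k), by rw [hr_encode]; exact hk⟩
  · intro a w
    have hsupp : Function.support (fun n => (r a n).elim 0 w) ⊆
        Set.range (Encodable.encode : ι × ℕ → ℕ) := by
      intro n hn
      rcases h : r a n with _ | x
      · simp [h] at hn
      · exact hr_range a n x h
    rw [← (Encodable.encode_injective (α := ι × ℕ)).tsum_eq hsupp, ENNReal.tsum_prod']
    refine tsum_congr fun i => ?_
    simp only [hr_encode]
    by_cases hdom : (R a i).Dom
    · obtain ⟨x, hx⟩ := Part.dom_iff_mem.1 hdom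
      obtain ⟨k, hk⟩ := hcompl (a, i) x hx
      rw [tsum_eq_single k]
      · rw [hk]
        refine le_antisymm (le_iSup₂_of_le x hx le_rfl) (iSup₂_le fun y hy => ?_)
        rw [Part.mem_unique hy hx]
        rfl
      · intro j hj
        rcases h : g (a, i) j with _ | y
        · rfl
        · exact absurd (huniq (a, i) j k (by simp [h]) (by simp [hk])) hj
    · have hnone : ∀ k, g (a, i) k = none := by
        intro k
        rcases h : g (a, i) k with _ | y
        · rfl
        · exact absurd (Part.dom_iff_mem.2 ⟨y, hsound _ _ _ h⟩) hdom
      have hmem : ∀ x, x ∉ R a i := fun x hx => hdom (Part.dom_iff_mem.2 ⟨x, hx⟩)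
      simp [hnone, hmem]

/-! ### Powers of one half and the Kraft inequality. -/

theorem ENNReal.two_pow_mul_inv_two_pow (m : ℕ) : (2 : ℝ≥0∞) ^ m * 2⁻¹ ^ m = 1 := by
  rw [← mul_pow, ENNReal.mul_inv_cancel (by norm_num) (by norm_num), one_pow]

theorem ENNReal.inv_two_pow_le_of_le {m n : ℕ} (h : m ≤ n) : (2⁻¹ : ℝ≥0∞) ^ n ≤ 2⁻¹ ^ m :=
  pow_le_pow_of_le_one zero_le (by simp) h

/-- The subtraction is truncated: for `n < m` the left side is `1` and the inequality is strict. -/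
theorem ENNReal.inv_two_pow_sub_le (n m : ℕ) : (2⁻¹ : ℝ≥0∞) ^ (n - m) ≤ 2 ^ m * 2⁻¹ ^ n := by
  calc (2⁻¹ : ℝ≥0∞) ^ (n - m) = 2 ^ m * 2⁻¹ ^ (n - m + m) := by
        rw [pow_add, mul_left_comm, two_pow_mul_inv_two_pow, mul_one]
    _ ≤ 2 ^ m * 2⁻¹ ^ n := by
        gcongr 2 ^ m * ?_
        exact inv_two_pow_le_of_le (n := n - m + m) (m := n) (by omega)

theorem ENNReal.exponent_le_of_le_two_pow_mul {c m n : ℕ}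
    (h : (2⁻¹ : ℝ≥0∞) ^ n ≤ 2 ^ c * 2⁻¹ ^ m) : m ≤ n + c := by
  by_contra! hlt
  obtain ⟨d, rfl⟩ := Nat.exists_eq_add_of_lt hlt
  have h1 : (2 : ℝ≥0∞) ^ c * 2⁻¹ ^ (n + c + d + 1) = 2⁻¹ ^ n * 2⁻¹ ^ (d + 1) := by
    rw [show n + c + d + 1 = c + (n + (d + 1)) by ring, pow_add, ← mul_assoc,
      two_pow_mul_inv_two_pow, one_mul, pow_add]
  have h2 : (2⁻¹ : ℝ≥0∞) ^ n * 2⁻¹ ^ (d + 1) < 2⁻¹ ^ n * 1 := by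
    refine ENNReal.mul_lt_mul_right (by simp) (by simp) ?_
    exact pow_lt_one₀ zero_le (by simp) (by simp)
  rw [h1] at h
  rw [mul_one] at h2
  exact absurd h (not_le.2 h2)

open InformationTheory in
theorem uniquelyDecodable_of_prefixFree {α : Type*} {S : Set (List α)}
    (hS : ∀ p ∈ S, ∀ q ∈ S, p <+: q → p = q) (hnil : [] ∉ S) : UniquelyDecodable S := by
  intro L₁
  induction L₁ with
  | nil =>
    rintro (_ | ⟨q, L₂⟩) - h2 h
    · rfl
    · simp only [List.flatten_nil, List.flatten_cons] at h
      have : q = [] := (List.append_eq_nil_iff.1 h.symm).1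
      exact absurd (this ▸ h2 q (by simp)) hnil
  | cons p L₁ ih =>
    rintro (_ | ⟨q, L₂⟩) h1 h2 h
    · simp only [List.flatten_nil, List.flatten_cons] at h
      have : p = [] := (List.append_eq_nil_iff.1 h).1
      exact absurd (this ▸ h1 p (by simp)) hnil
    · simp only [List.flatten_cons] at h
      have hpS := h1 p (by simp)
      have hqS := h2 q (by simp)
      have hpq : p = q := by
        rcases List.prefix_or_prefix_of_prefix (List.prefix_append p L₁.flatten)
          (h ▸ List.prefix_append q L₂.flatten) with h' | h'
        · exact hS p hpS q hqS h'
        · exact (hS q hqS p hpS h').symm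
      subst hpq
      rw [ih L₂ (fun w hw => h1 w (by simp [hw])) (fun w hw => h2 w (by simp [hw]))
        (List.append_cancel_left h)]

/-- The Kraft inequality for prefix-free sets of binary strings. -/
theorem tsum_prefixFree_le_one {S : Set (List Bool)}
    (hS : ∀ p ∈ S, ∀ q ∈ S, p <+: q → p = q) :
    ∑' p : List Bool, ⨆ _ : p ∈ S, (2⁻¹ : ℝ≥0∞) ^ p.length ≤ 1 := by
  classical
  -- A prefix-free set containing `[]` is `{[]}`, which is not uniquely decodable, so Kraft–McMillan
  -- covers only the other case.
  by_cases hnil : [] ∈ S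
  · rw [tsum_eq_single []]
    · simp
    · intro p hp
      have : p ∉ S := fun h => hp (hS [] hnil p h List.nil_prefix).symm
      simp [this]
  · rw [ENNReal.tsum_eq_iSup_sum]
    refine iSup_le fun s => ?_
    have hdec : InformationTheory.UniquelyDecodable
        ((s.filter (· ∈ S) : Finset _) : Set (List Bool)) := by
      refine uniquelyDecodable_of_prefixFree (fun p hp q hq => ?_) (by simp [hnil])
      exact hS p (by simp at hp; exact hp.2) q (by simp at hq; exact hq.2)
    have hk := ENNReal.ofReal_le_ofReal (InformationTheory.kraft_mcmillan_inequality hdec)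
    rw [ENNReal.ofReal_sum_of_nonneg (fun _ _ => by positivity), ENNReal.ofReal_one,
      Finset.sum_filter] at hk
    refine le_trans (Finset.sum_le_sum fun p _ => ?_) hk
    by_cases hp : p ∈ S
    · rw [if_pos hp, ENNReal.ofReal_pow (by positivity)]
      simp [hp, ENNReal.ofReal_inv_of_pos]
    · simp [hp]

/-! ### Complexity on a universal machine. -/

namespace PrefixMachine

variable {U : PrefixMachine}

theorem condComplexity_le {p s t : List Bool} (h : t ∈ U.eval p s) :
    U.condComplexity t s ≤ p.length :=
  Nat.sInf_le ⟨p, h, rfl⟩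

theorem IsUniversal.exists_program_length_eq (hU : U.IsUniversal) (t s : List Bool) :
    ∃ p : List Bool, t ∈ U.eval p s ∧ p.length = U.condComplexity t s := by
  obtain ⟨p, hp⟩ := hU.exists_program t s
  exact Nat.sInf_mem (s := {n : ℕ | ∃ p : List Bool, t ∈ U.eval p s ∧ p.length = n})
    ⟨_, p, hp, rfl⟩

theorem IsUniversal.mem_eval_star (hU : U.IsUniversal) (s : List Bool) :
    s ∈ U.eval (U.star s) [] := by
  have h : {p : List Bool | s ∈ U.eval p []}.Nonempty := hU.exists_program s []
  rw [star, dif_pos h]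
  exact WellFounded.min_mem (List.Shortlex.wf wellFounded_lt) {p : List Bool | s ∈ U.eval p []} h

theorem IsUniversal.length_star (hU : U.IsUniversal) (s : List Bool) :
    (U.star s).length = U.condComplexity s [] := by
  refine le_antisymm ?_ (condComplexity_le (hU.mem_eval_star s))
  obtain ⟨p, hp, hpl⟩ := hU.exists_program_length_eq s []
  have h : {p : List Bool | s ∈ U.eval p []}.Nonempty := hU.exists_program s []
  rw [← hpl, star, dif_pos h]
  by_contra! hlt
  exact WellFounded.not_lt_min (List.Shortlex.wf wellFounded_lt) {p : List Bool | s ∈ U.eval p []}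
    hp (List.Shortlex.of_length_lt hlt)

theorem IsUniversal.exists_complexity_le (hU : U.IsUniversal) (V : PrefixMachine) :
    ∃ c : ℕ, ∀ p s t : List Bool, t ∈ V.eval p s → U.condComplexity t s ≤ p.length + c := by
  obtain ⟨c, hc⟩ := hU V
  refine ⟨c, fun p s t h => ?_⟩
  obtain ⟨q, hq, hqp⟩ := hc s p t h
  exact (condComplexity_le hq).trans hqp

/-- The Kraft–Chaitin theorem: a computably indexed family of requests (a length and a string to be
described) whose weights add up to at most `1 / 2` is served up to an additive constant. -/
theorem IsUniversal.exists_complexity_le_of_requests (hU : U.IsUniversal) {ι : Type*}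
    [Primcodable ι] {R : List Bool → ι →. ℕ × List Bool} (hR : Partrec₂ R) :
    ∃ c : ℕ, ∀ s, ∑' i, ⨆ x ∈ R s i, (2⁻¹ : ℝ≥0∞) ^ x.1 ≤ 2⁻¹ →
      ∀ i l t, (l, t) ∈ R s i → U.condComplexity t s ≤ l + c := by
  obtain ⟨r, hr, hmem, hsum⟩ := exists_listing_of_partrec hR
  obtain ⟨c, hc⟩ := hU.exists_complexity_le (KraftChaitin.machine r hr)
  refine ⟨c, fun s hs i l t h => ?_⟩
  obtain ⟨n, hn⟩ := (hmem s (l, t)).2 ⟨i, h⟩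
  have hw : ∑' n, KraftChaitin.weight (r s n) ≤ 2⁻¹ := by
    refine le_trans (le_of_eq ?_) hs
    rw [← hsum]
    refine tsum_congr fun n => ?_
    cases r s n <;> rfl
  obtain ⟨p, rfl, hp⟩ := KraftChaitin.exists_mem_machine_eval hr hw hn
  exact hc p s t hp

/-! ### The coding theorem. -/

section codingTheorem

variable {F : List Bool →. List Bool}

/-- The total weight of the inputs at which `F` takes the value `a`. -/
noncomputable def mass (F : List Bool →. List Bool) (a : List Bool) : ℝ≥0∞ :=
  ∑' p : List Bool, ⨆ _ : a ∈ F p, 2⁻¹ ^ p.length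

/-- `F` is single-valued, so each input contributes to the mass of at most one value. -/
theorem tsum_mass_le : ∑' a, mass F a ≤ ∑' p, ⨆ _ : (F p).Dom, (2⁻¹ : ℝ≥0∞) ^ p.length := by
  unfold mass
  rw [ENNReal.tsum_comm]
  refine ENNReal.tsum_le_tsum fun p => ?_
  by_cases h : (F p).Dom
  · obtain ⟨x, hx⟩ := Part.dom_iff_mem.1 h
    rw [tsum_eq_single x]
    · simp [hx, h]
    · intro y hy
      have : y ∉ F p := fun hy' => hy (Part.mem_unique hy' hx)
      simp [this]
  · have : ∀ x, x ∉ F p := fun x hx => h (Part.dom_iff_mem.2 ⟨x, hx⟩)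
    simp [this]

/-- The dyadic rational `P + 2 ^ (-l)`. -/
def addWeight (P : ℕ × ℕ) (l : ℕ) : ℕ × ℕ := (P.1 * 2 ^ l + 2 ^ P.2, P.2 + l)

theorem primrec_addWeight : Primrec₂ addWeight := by
  have he : Primrec fun z : (ℕ × ℕ) × ℕ => z.1.2 := Primrec.snd.comp Primrec.fst
  have h2 : Primrec fun z : (ℕ × ℕ) × ℕ => 2 ^ z.1.2 :=
    KraftChaitin.primrec_pow.comp (Primrec.const 2) he
  have h2' : Primrec fun z : (ℕ × ℕ) × ℕ => 2 ^ z.2 :=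
    KraftChaitin.primrec_pow.comp (Primrec.const 2) Primrec.snd
  exact Primrec.pair (Primrec.nat_add.comp (Primrec.nat_mul.comp
    (Primrec.fst.comp Primrec.fst) h2') h2) (Primrec.nat_add.comp he Primrec.snd)

/-- The sum of `2 ^ (-l)` over the first `n` lengths in the list `q`, as a dyadic rational. -/
def partialSum (q : ℕ → Option ℕ) (n : ℕ) : ℕ × ℕ :=
  Nat.rec (0, 0) (fun n P => Option.casesOn (q n) P fun l => addWeight P l) n

theorem computable_partialSum {α : Type*} [Primcodable α] {q : α → ℕ → Option ℕ}
    (hq : Computable₂ q) : Computable₂ fun a n => partialSum (q a) n := by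
  refine Computable.nat_rec (h := fun (x : α × ℕ) (y : ℕ × ℕ × ℕ) =>
    Option.casesOn (q x.1 y.1) y.2 fun l => addWeight y.2 l)
    Computable.snd (Computable.const (0, 0)) ?_
  refine Computable.option_casesOn (hq.comp (Computable.fst.comp Computable.fst)
    (Computable.fst.comp Computable.snd)) (Computable.snd.comp Computable.snd) ?_
  exact primrec_addWeight.to_comp.comp
    (Computable.snd.comp (Computable.snd.comp Computable.fst)) Computable.snd

theorem partialSum_spec (q : ℕ → Option ℕ) (n : ℕ) :
    ((partialSum q n).1 : ℝ≥0∞) * 2⁻¹ ^ (partialSum q n).2 =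
      ∑ i ∈ Finset.range n, (q i).elim 0 fun l => 2⁻¹ ^ l := by
  induction n with
  | zero => simp [partialSum]
  | succ n ih =>
    rw [Finset.sum_range_succ, ← ih]
    rcases h : q n with _ | l
    · have : partialSum q (n + 1) = partialSum q n := by simp [partialSum, h]
      simp [this]
    · have : partialSum q (n + 1) =
          ((partialSum q n).1 * 2 ^ l + 2 ^ (partialSum q n).2, (partialSum q n).2 + l) := by
        simp [partialSum, addWeight, h]
      rw [this]
      generalize partialSum q n = P
      push_cast
      rw [add_mul, pow_add]
      have h1 : (P.1 : ℝ≥0∞) * 2 ^ l * (2⁻¹ ^ P.2 * 2⁻¹ ^ l) =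
          P.1 * 2⁻¹ ^ P.2 * (2 ^ l * 2⁻¹ ^ l) := by ring
      rw [h1, ENNReal.two_pow_mul_inv_two_pow, ← mul_assoc, ENNReal.two_pow_mul_inv_two_pow]
      simp

/-- Comparing integers makes it decidable whether a partial sum has reached `2 ^ (-k)`. -/
theorem two_pow_le_partialSum_iff (q : ℕ → Option ℕ) (n k : ℕ) :
    2 ^ (partialSum q n).2 ≤ (partialSum q n).1 * 2 ^ k ↔
      (2⁻¹ : ℝ≥0∞) ^ k ≤ ∑ i ∈ Finset.range n, (q i).elim 0 fun l => 2⁻¹ ^ l := by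
  rw [← partialSum_spec]
  generalize partialSum q n = P
  have h1 := ENNReal.two_pow_mul_inv_two_pow k
  have h2 := ENNReal.two_pow_mul_inv_two_pow P.2
  constructor
  · intro h
    have h' : (2 : ℝ≥0∞) ^ P.2 ≤ P.1 * 2 ^ k := by exact_mod_cast h
    calc (2⁻¹ : ℝ≥0∞) ^ k = 2 ^ P.2 * (2⁻¹ ^ P.2 * 2⁻¹ ^ k) := by
          rw [← mul_assoc, h2, one_mul]
      _ ≤ P.1 * 2 ^ k * (2⁻¹ ^ P.2 * 2⁻¹ ^ k) := by gcongr
      _ = P.1 * 2⁻¹ ^ P.2 * (2 ^ k * 2⁻¹ ^ k) := by ring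
      _ = _ := by rw [h1, mul_one]
  · intro h
    have : (2 : ℝ≥0∞) ^ P.2 ≤ P.1 * 2 ^ k := by
      calc (2 : ℝ≥0∞) ^ P.2 = 2⁻¹ ^ k * (2 ^ P.2 * 2 ^ k) := by
            rw [mul_left_comm, mul_comm (2⁻¹ ^ k), h1, mul_one]
        _ ≤ P.1 * 2⁻¹ ^ P.2 * (2 ^ P.2 * 2 ^ k) := by gcongr
        _ = P.1 * 2 ^ k * (2 ^ P.2 * 2⁻¹ ^ P.2) := by ring
        _ = _ := by rw [h2, mul_one]
    exact_mod_cast this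

theorem exists_computable_mass (hF : Partrec F) :
    ∃ q : List Bool → ℕ → Option ℕ, Computable₂ q ∧
      ∀ a, ∑' n, (q a n).elim 0 (fun l => (2⁻¹ : ℝ≥0∞) ^ l) = mass F a := by
  let R : List Bool → List Bool →. ℕ := fun a p => (F p).bind fun a' =>
    ((if a' = a then some p.length else none : Option ℕ) : Part ℕ)
  have hR : Partrec₂ R := by
    refine Partrec.bind (hF.comp Computable.snd) (Computable.ofOption ?_)
    exact Computable.option_ite_eq Computable.snd (Computable.fst.comp Computable.fst)
      (Computable.list_length.comp (Computable.snd.comp Computable.fst))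
  obtain ⟨q, hq, -, hsum⟩ := exists_listing_of_partrec hR
  refine ⟨q, hq, fun a => ?_⟩
  rw [hsum]
  refine tsum_congr fun p => ?_
  have hmem : ∀ l, l ∈ R a p ↔ a ∈ F p ∧ l = p.length := by
    intro l
    simp only [R, Part.mem_bind_iff, Part.mem_ofOption, Option.mem_def,
      Option.ite_none_right_eq_some, Option.some.injEq]
    constructor
    · rintro ⟨_, h, rfl, rfl⟩
      exact ⟨h, rfl⟩
    · rintro ⟨h, rfl⟩
      exact ⟨a, h, rfl, rfl⟩
  simp only [hmem, iSup_and]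
  rw [iSup_comm]
  simp only [iSup_iSup_eq_left]

/-- With `k₀` the least `k` satisfying `P`, the sum is at most the geometric tail `2 ^ (-k₀) / 2`.
-/
theorem tsum_inv_two_pow_le {P : ℕ → Prop} {m : ℝ≥0∞} (h : ∀ k, P k → 2⁻¹ ^ k ≤ m) :
    ∑' k, ⨆ _ : P k, (2⁻¹ : ℝ≥0∞) ^ (k + 2) ≤ 2⁻¹ * m := by
  classical
  by_cases hex : ∃ k, P k
  · set k₀ := Nat.find hex with hk₀
    have hsupp : Function.support (fun k => ⨆ _ : P k, (2⁻¹ : ℝ≥0∞) ^ (k + 2)) ⊆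
        Set.range (· + k₀) := by
      intro k hk
      have hPk : P k := by
        by_contra hn
        simp [hn] at hk
      exact ⟨k - k₀, Nat.sub_add_cancel (Nat.find_min' hex hPk)⟩
    rw [← (add_left_injective k₀).tsum_eq hsupp]
    calc _ ≤ ∑' j, (2⁻¹ : ℝ≥0∞) ^ j * 2⁻¹ ^ (k₀ + 2) := by
          refine ENNReal.tsum_le_tsum fun j => iSup_le fun _ => ?_
          rw [← pow_add, add_assoc]
      _ = 2⁻¹ * 2⁻¹ ^ k₀ := by
          rw [ENNReal.tsum_mul_right, ENNReal.tsum_geometric, ENNReal.one_sub_inv_two, inv_inv,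
            pow_add, pow_two]
          have := ENNReal.two_pow_mul_inv_two_pow 1
          rw [pow_one, pow_one] at this
          calc (2 : ℝ≥0∞) * (2⁻¹ ^ k₀ * (2⁻¹ * 2⁻¹)) = (2 * 2⁻¹) * (2⁻¹ * 2⁻¹ ^ k₀) := by ring
            _ = _ := by rw [this, one_mul]
      _ ≤ _ := by
          gcongr
          exact h _ (Nat.find_spec hex)
  · push Not at hex
    simp [hex]

/-- The coding theorem. -/
theorem IsUniversal.exists_mass_le (hU : U.IsUniversal) (hF : Partrec F)
    (hdom : ∑' p, ⨆ _ : (F p).Dom, (2⁻¹ : ℝ≥0∞) ^ p.length ≤ 1) :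
    ∃ c : ℕ, ∀ a, mass F a ≤ 2 ^ c * 2⁻¹ ^ U.condComplexity a [] := by
  obtain ⟨q, hq, hmass⟩ := exists_computable_mass hF
  -- Once the mass of `a` is seen to reach `2 ^ (-k)`, a description of `a` of length `k + 2` is
  -- requested. The extra `2` keeps the requests for `a` below half its mass, hence all of them
  -- below `1 / 2`.
  let R : List Bool → List Bool × ℕ →. ℕ × List Bool := fun _ y =>
    Nat.rfindOpt fun n => bif decide (2 ^ (partialSum (q y.1) n).2 ≤
      (partialSum (q y.1) n).1 * 2 ^ y.2) then some (y.2 + 2, y.1) else none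
  have hR : Partrec₂ R := by
    refine Partrec.rfindOpt ?_
    have hy : Computable fun x : (List Bool × List Bool × ℕ) × ℕ => x.1.2 :=
      Computable.snd.comp Computable.fst
    have hP : Computable fun x : (List Bool × List Bool × ℕ) × ℕ => partialSum (q x.1.2.1) x.2 :=
      (computable_partialSum hq).comp (Computable.fst.comp hy) Computable.snd
    have hpow := KraftChaitin.primrec_pow.to_comp
    refine Computable.cond ?_ ?_ (Computable.const none)
    · refine Primrec.nat_le.decide.to_comp.comp (hpow.comp (Computable.const 2)
        (Computable.snd.comp hP)) ?_
      exact Primrec.nat_mul.to_comp.comp (Computable.fst.comp hP)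
        (hpow.comp (Computable.const 2) (Computable.snd.comp hy))
    · refine Computable.option_some.comp (Computable.pair ?_ (Computable.fst.comp hy))
      exact Computable.succ.comp (Computable.succ.comp (Computable.snd.comp hy))
  have hmem : ∀ s a k x, x ∈ R s (a, k) ↔ x = (k + 2, a) ∧ ∃ n, (2⁻¹ : ℝ≥0∞) ^ k ≤
      ∑ i ∈ Finset.range n, (q a i).elim 0 fun l => 2⁻¹ ^ l := by
    intro s a k x
    have hspec : ∀ n x, x ∈ (bif decide (2 ^ (partialSum (q a) n).2 ≤
        (partialSum (q a) n).1 * 2 ^ k) then some (k + 2, a) else none) ↔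
        x = (k + 2, a) ∧ (2⁻¹ : ℝ≥0∞) ^ k ≤
          ∑ i ∈ Finset.range n, (q a i).elim 0 fun l => 2⁻¹ ^ l := by
      intro n x
      rw [← two_pow_le_partialSum_iff, Bool.cond_decide, Option.mem_def,
        Option.ite_none_right_eq_some, Option.some.injEq, and_comm, eq_comm]
    constructor
    · intro h
      obtain ⟨n, hn⟩ := Nat.rfindOpt_spec h
      exact ⟨((hspec n x).1 hn).1, n, ((hspec n x).1 hn).2⟩
    · rintro ⟨rfl, n, hn⟩
      have hd : (R s (a, k)).Dom := Nat.rfindOpt_dom.2 ⟨n, _, (hspec n _).2 ⟨rfl, hn⟩⟩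
      obtain ⟨m, hm⟩ := Nat.rfindOpt_spec (Part.get_mem hd)
      rw [← ((hspec m _).1 hm).1]
      exact Part.get_mem hd
  obtain ⟨c, hc⟩ := hU.exists_complexity_le_of_requests hR
  have hsum : ∑' y, ⨆ x ∈ R [] y, (2⁻¹ : ℝ≥0∞) ^ x.1 ≤ 2⁻¹ := by
    rw [ENNReal.tsum_prod']
    calc _ ≤ ∑' a, 2⁻¹ * mass F a := by
          refine ENNReal.tsum_le_tsum fun a => ?_
          refine le_trans (le_of_eq ?_) (tsum_inv_two_pow_le (P := fun k => ∃ n,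
            (2⁻¹ : ℝ≥0∞) ^ k ≤ ∑ i ∈ Finset.range n, (q a i).elim 0 fun l => 2⁻¹ ^ l) ?_)
          · refine tsum_congr fun k => ?_
            simp only [hmem, iSup_and, iSup_iSup_eq_left]
          · rintro k ⟨n, hn⟩
            rw [← hmass]
            exact hn.trans (ENNReal.sum_le_tsum _)
      _ ≤ 2⁻¹ * 1 := by
          rw [ENNReal.tsum_mul_left]
          gcongr
          exact tsum_mass_le.trans hdom
      _ = 2⁻¹ := mul_one _
  -- Here `2` comes from the request length `k + 2`, and `1` makes the resulting bound contradict
  -- `K(a)`. If `K(a) ≤ c + 3`, the bound holds because the mass is at most `1`.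
  refine ⟨c + 3, fun a => ?_⟩
  by_contra! hlt
  rcases le_or_gt (U.condComplexity a []) (c + 3) with hK | hK
  · have h1 : (1 : ℝ≥0∞) ≤ 2 ^ (c + 3) * 2⁻¹ ^ U.condComplexity a [] := by
      rw [← ENNReal.two_pow_mul_inv_two_pow (c + 3)]
      gcongr 2 ^ (c + 3) * ?_
      exact ENNReal.inv_two_pow_le_of_le hK
    have h2 : mass F a ≤ 1 := (ENNReal.le_tsum a).trans (tsum_mass_le.trans hdom)
    exact absurd (h1.trans_lt hlt) (not_lt.2 h2)
  · obtain ⟨k, hk⟩ := Nat.exists_eq_add_of_lt hK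
    rw [hk, show c + 3 + k + 1 = (c + 3) + (k + 1) by ring, pow_add 2⁻¹, ← mul_assoc,
      ENNReal.two_pow_mul_inv_two_pow, one_mul, ← hmass, ENNReal.tsum_eq_iSup_nat, lt_iSup_iff]
      at hlt
    obtain ⟨n, hn⟩ := hlt
    have := hc [] hsum (a, k + 1) _ _ ((hmem [] a (k + 1) _).2 ⟨rfl, n, hn.le⟩)
    omega

end codingTheorem

/-! ### Symmetry of information. -/

theorem exists_partrec_unpair {pair : List Bool → List Bool → List Bool} (hpair : Computable₂ pair)
    (hinj : Function.Injective2 pair) :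
    ∃ d : List Bool →. List Bool × List Bool, Partrec d ∧
      ∀ w y, y ∈ d w ↔ pair y.1 y.2 = w := by
  let f : List Bool → ℕ → Option (List Bool × List Bool) := fun w n =>
    (Encodable.decode n).bind fun y : List Bool × List Bool =>
      if pair y.1 y.2 = w then some y else none
  have hf : Computable₂ f := by
    refine Computable.option_bind (Computable.decode.comp Computable.snd) ?_
    exact Computable.option_ite_eq (hpair.comp (Computable.fst.comp Computable.snd)
      (Computable.snd.comp Computable.snd)) (Computable.fst.comp Computable.fst) Computable.snd
  have hspec : ∀ w n y, y ∈ f w n → pair y.1 y.2 = w := by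
    intro w n y h
    obtain ⟨z, -, hz⟩ := Option.bind_eq_some_iff.1 h
    rw [Option.ite_none_right_eq_some, Option.some.injEq] at hz
    exact hz.2 ▸ hz.1
  refine ⟨fun w => Nat.rfindOpt (f w), Partrec.rfindOpt hf, fun w y => ⟨fun h => ?_, ?_⟩⟩
  · obtain ⟨n, hn⟩ := Nat.rfindOpt_spec h
    exact hspec w n y hn
  · rintro rfl
    have hd : (Nat.rfindOpt (f (pair y.1 y.2))).Dom :=
      Nat.rfindOpt_dom.2 ⟨Encodable.encode y, y, by
        simp only [f, Encodable.encodek, Option.bind_some, if_true, Option.mem_def]⟩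
    obtain ⟨n, hn⟩ := Nat.rfindOpt_spec (Part.get_mem hd)
    obtain ⟨h1, h2⟩ := hinj (hspec _ n _ hn)
    have hmem := Part.get_mem hd
    rwa [Prod.ext h1 h2] at hmem

/-- The hard half of the symmetry of information. -/
theorem IsUniversal.exists_condComplexity_add_le (hU : U.IsUniversal)
    {pair : List Bool → List Bool → List Bool} (hpair : Computable₂ pair)
    (hinj : Function.Injective2 pair) :
    ∃ c : ℕ, ∀ a b, U.condComplexity b (U.star a) + U.condComplexity a [] ≤
      U.condComplexity (pair a b) [] + c := by
  obtain ⟨d, hd, hdmem⟩ := exists_partrec_unpair hpair hinj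
  have heval : Partrec fun p => U.eval p [] :=
    U.partrec.comp Computable.id (Computable.const [])
  let D : List Bool →. List Bool × List Bool := fun p => (U.eval p []).bind d
  have hD : Partrec D := heval.bind (hd.comp Computable.snd)
  have hDmem : ∀ p y, y ∈ D p ↔ pair y.1 y.2 ∈ U.eval p [] := by
    intro p y
    refine Part.mem_bind_iff.trans ?_
    simp only [hdmem, exists_eq_right']
  let F : List Bool →. List Bool := fun p => (D p).map Prod.fst
  have hF : Partrec F := hD.map (Computable.fst.comp Computable.snd)
  have hdom : ∑' p, ⨆ _ : (F p).Dom, (2⁻¹ : ℝ≥0∞) ^ p.length ≤ 1 := by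
    refine tsum_prefixFree_le_one (S := {p | (F p).Dom}) fun p hp q hq => ?_
    exact U.prefixFree [] p q hp.1 hq.1
  obtain ⟨c, hc⟩ := hU.exists_mass_le hF hdom
  -- For `s = a^*` the machine recovers `a`, and `s.length` is `K(a)`. Each program `p` of a pair
  -- `(a, b)` requests `b` at length about `p.length - K(a)`. By the coding theorem `c` offsets the
  -- constant in the mass bound, and the extra `1` brings the total down to `1 / 2`.
  let R : List Bool → List Bool →. ℕ × List Bool := fun s p =>
    (U.eval s []).bind fun a => (D p).bind fun y =>
      ((if y.1 = a then some (p.length + (c + 1) - s.length, y.2) else none :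
        Option (ℕ × List Bool)) : Part (ℕ × List Bool))
  have hR : Partrec₂ R := by
    refine Partrec.bind (heval.comp Computable.fst) ?_
    refine Partrec.bind (hD.comp (Computable.snd.comp Computable.fst)) (Computable.ofOption ?_)
    refine Computable.option_ite_eq (Computable.fst.comp Computable.snd)
      (Computable.snd.comp Computable.fst) (Computable.pair ?_ (Computable.snd.comp Computable.snd))
    have hsp : Computable fun x : ((List Bool × List Bool) × List Bool) × List Bool × List Bool =>
        x.1.1 := Computable.fst.comp Computable.fst
    exact Primrec.nat_sub.to_comp.comp (Primrec.nat_add.to_comp.comp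
      (Computable.list_length.comp (Computable.snd.comp hsp)) (Computable.const (c + 1)))
      (Computable.list_length.comp (Computable.fst.comp hsp))
  have hmem : ∀ a p x, x ∈ R (U.star a) p ↔
      (a, x.2) ∈ D p ∧ x.1 = p.length + (c + 1) - (U.star a).length := by
    rintro a p ⟨l, t⟩
    simp only [R, Part.eq_some_iff.2 (hU.mem_eval_star a), Part.bind_some, Part.mem_bind_iff,
      Part.mem_ofOption, Option.mem_def, Option.ite_none_right_eq_some, Option.some.injEq,
      Prod.mk.injEq]
    constructor
    · rintro ⟨y, hy, rfl, rfl, rfl⟩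
      exact ⟨hy, rfl⟩
    · rintro ⟨hy, rfl⟩
      exact ⟨_, hy, rfl, rfl, rfl⟩
  have hsum : ∀ a, ∑' p, ⨆ x ∈ R (U.star a) p, (2⁻¹ : ℝ≥0∞) ^ x.1 ≤ 2⁻¹ := by
    intro a
    have hK := hU.length_star a
    set k := (U.star a).length
    calc _ ≤ ∑' p : List Bool, 2 ^ k * 2⁻¹ ^ (c + 1) * ⨆ _ : a ∈ F p, (2⁻¹ : ℝ≥0∞) ^ p.length := by
          refine ENNReal.tsum_le_tsum fun p => iSup₂_le fun x hx => ?_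
          obtain ⟨hx1, hx2⟩ := (hmem a p x).1 hx
          have haF : a ∈ F p := Part.mem_map Prod.fst hx1
          rw [hx2, iSup_pos haF]
          refine (ENNReal.inv_two_pow_sub_le _ _).trans (le_of_eq ?_)
          rw [pow_add _ p.length]
          ring
      _ = 2 ^ k * 2⁻¹ ^ (c + 1) * mass F a := ENNReal.tsum_mul_left
      _ ≤ 2 ^ k * 2⁻¹ ^ (c + 1) * (2 ^ c * 2⁻¹ ^ k) := by
          gcongr
          rw [hK]
          exact hc a
      _ = (2 ^ k * 2⁻¹ ^ k) * (2 ^ c * 2⁻¹ ^ c) * 2⁻¹ := by ring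
      _ = 2⁻¹ := by simp only [ENNReal.two_pow_mul_inv_two_pow, one_mul]
  obtain ⟨c', hc'⟩ := hU.exists_complexity_le_of_requests hR
  refine ⟨c + c' + 1, fun a b => ?_⟩
  obtain ⟨p, hp, hpl⟩ := hU.exists_program_length_eq (pair a b) []
  have hpD : (a, b) ∈ D p := (hDmem p (a, b)).2 hp
  have h1 := hc' (U.star a) (hsum a) p _ b ((hmem a p (_, b)).2 ⟨hpD, rfl⟩)
  -- The weight of `p` alone is part of the mass of `a`. This bound shows that the subtraction in
  -- the requested length is not truncated.
  have h2 : U.condComplexity a [] ≤ p.length + c := by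
    refine ENNReal.exponent_le_of_le_two_pow_mul (le_trans ?_ (hc a))
    refine le_trans ?_ (ENNReal.le_tsum p)
    rw [iSup_pos (Part.mem_map Prod.fst hpD : a ∈ F p)]
  rw [hU.length_star] at h1
  omega

/-! ### Concatenated programs for a triple. -/

theorem eq_of_append_prefix {s p q u v : List Bool} (hp : (U.eval p s).Dom) (hq : (U.eval q s).Dom)
    (h : p ++ u <+: q ++ v) : p = q := by
  rcases List.prefix_or_prefix_of_prefix ((List.prefix_append p u).trans h)
    (List.prefix_append q v) with h' | h'
  · exact U.prefixFree s p q hp hq h'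
  · exact (U.prefixFree s q p hq hp h').symm

/-- A program of `x` followed by programs of `y` and `z` under the condition of that program is a
program of the triple. -/
theorem IsUniversal.exists_triple_le (hU : U.IsUniversal)
    {pair : List Bool → List Bool → List Bool} (hpair : Computable₂ pair) :
    ∃ c : ℕ, ∀ x y z, U.condComplexity (pair (pair x y) z) [] ≤ U.condComplexity x [] +
      U.condComplexity y (U.star x) + U.condComplexity z (U.star x) + c := by
  let W : List Bool × List Bool × List Bool →. List Bool := fun y =>
    (U.eval y.1 []).bind fun a => (U.eval y.2.1 y.1).bind fun b =>
      (U.eval y.2.2 y.1).map fun e => pair (pair a b) e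
  have hW : Partrec W := by
    refine Partrec.bind (U.partrec.comp Computable.fst (Computable.const [])) ?_
    refine Partrec.bind (U.partrec.comp (Computable.fst.comp (Computable.snd.comp Computable.fst))
      (Computable.fst.comp Computable.fst)) ?_
    refine Partrec.map (U.partrec.comp (Computable.snd.comp (Computable.snd.comp
      (Computable.fst.comp Computable.fst)))
      (Computable.fst.comp (Computable.fst.comp Computable.fst))) ?_
    exact hpair.comp (hpair.comp (Computable.snd.comp (Computable.fst.comp Computable.fst))
      (Computable.snd.comp Computable.fst)) Computable.snd
  -- All splittings of `p` into three pieces are tried in parallel; `hprefix` shows that at most one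
  -- of them halts.
  let R : List Bool → List Bool × List Bool × List Bool →. List Bool := fun p y =>
    Part.bind ((if y.1 ++ (y.2.1 ++ y.2.2) = p then some y else none : Option _) : Part _) W
  have hR : Partrec₂ R := by
    refine Partrec.bind (Computable.ofOption ?_) (hW.comp Computable.snd)
    refine Computable.option_ite_eq ?_ Computable.fst Computable.snd
    have hy : Computable fun x : List Bool × List Bool × List Bool × List Bool => x.2.2 :=
      Computable.snd.comp Computable.snd
    exact Computable.list_append.comp (Computable.fst.comp Computable.snd)
      (Computable.list_append.comp (Computable.fst.comp hy) (Computable.snd.comp hy))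
  have hmem : ∀ p y t, t ∈ R p y ↔ y.1 ++ (y.2.1 ++ y.2.2) = p ∧ t ∈ W y := by
    intro p y t
    refine Part.mem_bind_iff.trans ?_
    simp only [Part.mem_ofOption, Option.mem_def, Option.ite_none_right_eq_some, Option.some.injEq]
    constructor
    · rintro ⟨_, ⟨h, rfl⟩, ht⟩
      exact ⟨h, ht⟩
    · rintro ⟨h, ht⟩
      exact ⟨y, ⟨h, rfl⟩, ht⟩
  have hWdom : ∀ y, (W y).Dom →
      (U.eval y.1 []).Dom ∧ (U.eval y.2.1 y.1).Dom ∧ (U.eval y.2.2 y.1).Dom :=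
    fun y ⟨h1, h2, h3⟩ => ⟨h1, h2, h3⟩
  have hprefix : ∀ y y', (W y).Dom → (W y').Dom →
      y.1 ++ (y.2.1 ++ y.2.2) <+: y'.1 ++ (y'.2.1 ++ y'.2.2) → y = y' := by
    rintro ⟨p₁, p₂, p₃⟩ ⟨q₁, q₂, q₃⟩ hy hy' h
    obtain ⟨h1, h2, h3⟩ := hWdom _ hy
    obtain ⟨h1', h2', h3'⟩ := hWdom _ hy'
    dsimp only at *
    -- The first piece must be identified first: it is the condition under which the other two
    -- pieces are prefix-free.
    obtain rfl := eq_of_append_prefix h1 h1' h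
    rw [List.prefix_append_right_inj] at h
    obtain rfl := eq_of_append_prefix h2 h2' h
    rw [List.prefix_append_right_inj] at h
    rw [U.prefixFree _ _ _ h3 h3' h]
  obtain ⟨r, hr, hrmem, -⟩ := exists_listing_of_partrec hR
  have hout : ∀ p t, t ∈ Nat.rfindOpt (r p) → ∃ y, y.1 ++ (y.2.1 ++ y.2.2) = p ∧ t ∈ W y := by
    intro p t ht
    obtain ⟨n, hn⟩ := Nat.rfindOpt_spec ht
    obtain ⟨y, hy⟩ := (hrmem p t).1 ⟨n, hn⟩
    exact ⟨y, (hmem p y t).1 hy⟩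
  let V : PrefixMachine :=
    { eval := fun p _ => Nat.rfindOpt (r p)
      partrec := (Partrec.rfindOpt hr).comp Computable.fst
      prefixFree := by
        intro s p q hp hq hpq
        obtain ⟨y, rfl, hy⟩ := hout p _ (Part.get_mem hp)
        obtain ⟨y', rfl, hy'⟩ := hout q _ (Part.get_mem hq)
        rw [hprefix y y' hy.1 hy'.1 hpq] }
  obtain ⟨c, hc⟩ := hU.exists_complexity_le V
  refine ⟨c, fun x y z => ?_⟩
  have hx := hU.mem_eval_star x
  obtain ⟨p, hp, hpl⟩ := hU.exists_program_length_eq y (U.star x)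
  obtain ⟨q, hq, hql⟩ := hU.exists_program_length_eq z (U.star x)
  have hWt : pair (pair x y) z ∈ W (U.star x, p, q) := by
    simp only [W, Part.mem_bind_iff, Part.mem_map_iff]
    exact ⟨x, hx, y, hp, z, hq, rfl⟩
  have hV : pair (pair x y) z ∈ V.eval (U.star x ++ (p ++ q)) [] := by
    obtain ⟨n, hn⟩ := (hrmem (U.star x ++ (p ++ q)) (pair (pair x y) z)).2
      ⟨(U.star x, p, q), (hmem _ _ _).2 ⟨rfl, hWt⟩⟩
    have hd : (Nat.rfindOpt (r (U.star x ++ (p ++ q)))).Dom := Nat.rfindOpt_dom.2 ⟨n, _, hn⟩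
    obtain ⟨y', hy', hmem'⟩ := hout _ _ (Part.get_mem hd)
    obtain rfl := hprefix y' (U.star x, p, q) hmem'.1 hWt.1 (by rw [hy'])
    rw [Part.mem_unique hWt hmem']
    exact Part.get_mem hd
  have := hc _ _ _ hV
  rw [List.length_append, List.length_append, hU.length_star, hpl, hql] at this
  omega

end PrefixMachine

/-! ### Monotonicity of conditional information. -/

theorem mainTheorem5 (U : PrefixMachine) (hU : U.IsUniversal)
    (pair : List Bool → List Bool → List Bool) (hpair : Computable₂ pair)
    (hinj : Function.Injective2 pair) :
    ∃ c : ℕ, ∀ x y z : List Bool,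
      U.condComplexity z (U.star (pair x y)) ≤ U.condComplexity z (U.star x) + c := by
  obtain ⟨c₁, h₁⟩ := hU.exists_condComplexity_add_le hpair hinj
  obtain ⟨c₂, h₂⟩ := hU.exists_triple_le hpair
  -- Symmetry of information is used twice, for `((x, y), z)` and for `(x, y)`.
  refine ⟨c₁ + c₁ + c₂, fun x y z => ?_⟩
  have h := h₁ (pair x y) z
  have h' := h₁ x y
  have h'' := h₂ x y z
  omega
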